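/- Let $n\ge 3$. A function $V:(0,\infty)\to\mathbb R$ is called a potential if it is strictly convex, decreasing and three times continuously differentiable and, with $\nu_V(z)=-zV'(z)$ and $\beta_V(z)=z\nu_V'(z)/\nu_V(z)$, satisfies $\nu_V(z)>0$ and $\beta_V(z)<1/n$ for all $z>0$, and $\lim_{z\to+0}z/\nu_V(z)^{n-1}=0$. Let $\mathrm{PD}(n)$ be the set of real symmetric positive definite $n\times n$ matrices, and let $D_V(P,Q)=\varphi(P)-\varphi(Q)-\langle\nabla\varphi(Q),P-Q\rangle$ be the Bregman divergence of $\varphi(P)=V(\det P)$, where $\langle A,B\rangle=\operatorname{tr}(AB^\top)$ and $\|A\|_F=\sqrt{\langle A,A\rangle}$. Let $s,y\in\mathbb R^n$ satisfy $s^\top y>0$ and let $\mathcal Y\subset\mathbb R^n$ be bounded. For a potential $V$, $B_k\in\mathrm{PD}(n)$, $\bar y\in\mathbb R^n$ and small $\varepsilon\in\mathbb R$ let $B(\varepsilon)$ be the optimal solution of $$\min_{B\in\mathrm{PD}(n)}D_V(B,B_k)\quad\text{subject to}\quad(1+\varepsilon)Bs=y+\varepsilon\bar y ,$$ let $\dot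 B(0)$ be the derivative of $B(\varepsilon)$ at $\varepsilon=0$, and define the gross error sensitivity of $V$ as $$\gamma(V)=\sup\{\|\dot B(0)\|_F : B_k\in\mathrm{PD}(n),\ \bar y\in\mathcal Y\}\in[0,\infty]\qquad(\sup\emptyset=0).$$ Theorem. 1. For every potential $V$, every $B_k\in\mathrm{PD}(n)$ and every $\bar y\in\mathbb R^n$, the optimal solution $B(\varepsilon)$ exists and is unique for all sufficiently small $\varepsilon$, and it is differentiable at $\varepsilon=0$. 2. Every function $V(z)=-c\log z+d$ with constants $c>0$ and $d\in\mathbb R$ is a potential that minimizes $\gamma$ among all potentials, and $\gamma(V)<\infty$. For such $V$ the $V$-BFGS update, i.e. the unique minimizer of $D_V(B,B_k)$ over the $B\in\mathrm{PD}(n)$ with $Bs=y$, is the standard BFGS update $B_k-\dfrac{B_kss^\top B_k}{s^\top B_ks}+\dfrac{yy^\top}{s^\top y}$, for every $B_k\in\mathrm{PD}(n)$. 3. If $s^\top\bar y\ne s^\top y$ for some $\bar y\in\mathcal Y$, then for every potential $V$ the following are equivalent: $V$ minimizes $\gamma$ among all potentials; $\gamma(V)<\infty$; $V(z)=-c\log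 z+d$ for some constants $c>0$ and $d\in\mathbb R$. 4. If $s^\top\bar y=s^\top y$ for all $\bar y\in\mathcal Y$, then $\gamma$ takes the same value for all potentials. -/

import Mathlib

open Set Filter Topology Matrix
open scoped ENNReal

noncomputable section

namespace QuasiNewton

/-- `ν_V(z) = -z V'(z)`. -/
def nu (V : ℝ → ℝ) (z : ℝ) : ℝ := -z * deriv V z

/-- `β_V(z) = z ν_V'(z) / ν_V(z)`. -/
def beta (V : ℝ → ℝ) (z : ℝ) : ℝ := z * deriv (nu V) z / nu V z

/-- Potential functions for `n × n` matrices. A function on the positive reals is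
represented by a function on `ℝ` of which only the values on `(0, ∞)` matter. -/
structure IsPotential (n : ℕ) (V : ℝ → ℝ) : Prop where
  strictConvexOn : StrictConvexOn ℝ (Ioi 0) V
  antitoneOn : AntitoneOn V (Ioi 0)
  contDiffOn : ContDiffOn ℝ 3 V (Ioi 0)
  nu_pos : ∀ z : ℝ, 0 < z → 0 < nu V z
  beta_lt : ∀ z : ℝ, 0 < z → beta V z < 1 / (n : ℝ)
  tendsto_zero : Tendsto (fun z : ℝ => z / nu V z ^ (n - 1)) (𝓝[>] 0) (𝓝 0)

/-- The inner product `⟨A, B⟩ = tr (A Bᵀ)`. -/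
def frobInner {n : ℕ} (A B : Matrix (Fin n) (Fin n) ℝ) : ℝ := (A * Bᵀ).trace

/-- The Frobenius norm `‖A‖_F = √⟨A, A⟩`. -/
def frobNorm {n : ℕ} (A : Matrix (Fin n) (Fin n) ℝ) : ℝ := Real.sqrt (frobInner A A)

/-- The matrix of partial derivatives `∂φ/∂Q_{ij}` at `Q`. -/
def grad {n : ℕ} (φ : Matrix (Fin n) (Fin n) ℝ → ℝ) (Q : Matrix (Fin n) (Fin n) ℝ) :
    Matrix (Fin n) (Fin n) ℝ :=
  Matrix.of fun i j => deriv (fun t : ℝ => φ (Q + t • Matrix.single i j (1 : ℝ))) 0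

/-- The Bregman divergence `φ(P) - φ(Q) - ⟨∇φ(Q), P - Q⟩`. -/
def bregman {n : ℕ} (φ : Matrix (Fin n) (Fin n) ℝ → ℝ) (P Q : Matrix (Fin n) (Fin n) ℝ) : ℝ :=
  φ P - φ Q - frobInner (grad φ Q) (P - Q)

/-- The `V`-Bregman divergence, induced by `φ(P) = V(det P)`. -/
def vBregman {n : ℕ} (V : ℝ → ℝ) (P Q : Matrix (Fin n) (Fin n) ℝ) : ℝ :=
  bregman (fun M : Matrix (Fin n) (Fin n) ℝ => V M.det) P Q

/-- `B` is an optimal solution of the `V`-BFGS problem: minimize `D_V(B, Bk)` over the positive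
definite matrices `B` with `B s = y`. -/
def IsVBFGSUpdate {n : ℕ} (V : ℝ → ℝ) (Bk : Matrix (Fin n) (Fin n) ℝ) (s y : Fin n → ℝ)
    (B : Matrix (Fin n) (Fin n) ℝ) : Prop :=
  B.PosDef ∧ B *ᵥ s = y ∧
    ∀ B' : Matrix (Fin n) (Fin n) ℝ, B'.PosDef → B' *ᵥ s = y → vBregman V B Bk ≤ vBregman V B' Bk

/-- The standard BFGS formula
`Bk - (Bk s sᵀ Bk) / (sᵀ Bk s) + (y yᵀ) / (sᵀ y)`. -/
def bfgs {n : ℕ} (Bk : Matrix (Fin n) (Fin n) ℝ) (s y : Fin n → ℝ) :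
    Matrix (Fin n) (Fin n) ℝ :=
  Bk - (s ⬝ᵥ Bk *ᵥ s)⁻¹ • (Bk * vecMulVec s s * Bk) + (s ⬝ᵥ y)⁻¹ • vecMulVec y y

/-- `B` is an optimal solution of the perturbed problem: minimize `D_V(B, Bk)` over the positive
definite matrices `B` with `(1 + ε) B s = y + ε ȳ`. -/
def IsPerturbedUpdate {n : ℕ} (V : ℝ → ℝ) (Bk : Matrix (Fin n) (Fin n) ℝ) (s y ybar : Fin n → ℝ)
    (ε : ℝ) (B : Matrix (Fin n) (Fin n) ℝ) : Prop :=
  IsVBFGSUpdate V Bk ((1 + ε) • s) (y + ε • ybar) B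

open Classical in
/-- The curve `ε ↦ B(ε)` of optimal solutions of the perturbed problem (with value `0` where the
problem has no optimal solution). -/
def perturbedUpdate {n : ℕ} (V : ℝ → ℝ) (Bk : Matrix (Fin n) (Fin n) ℝ) (s y ybar : Fin n → ℝ)
    (ε : ℝ) : Matrix (Fin n) (Fin n) ℝ :=
  if h : ∃ B, IsPerturbedUpdate V Bk s y ybar ε B then h.choose else 0

/-- The influence function, i.e. the derivative of `B(ε)` at `ε = 0`. -/
def influence {n : ℕ} (V : ℝ → ℝ) (Bk : Matrix (Fin n) (Fin n) ℝ) (s y ybar : Fin n → ℝ) :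
    Matrix (Fin n) (Fin n) ℝ :=
  deriv (perturbedUpdate V Bk s y ybar) 0

/-- The gross error sensitivity: the supremum, in `[0, ∞]`, of the Frobenius norm of the influence
function over all positive definite `Bk` and all `ȳ ∈ Y`. -/
def grossErrorSensitivity {n : ℕ} (V : ℝ → ℝ) (s y : Fin n → ℝ) (Y : Set (Fin n → ℝ)) : ℝ≥0∞ :=
  ⨆ (Bk : Matrix (Fin n) (Fin n) ℝ) (_ : Bk.PosDef) (ybar : Fin n → ℝ) (_ : ybar ∈ Y),
    ENNReal.ofReal (frobNorm (influence V Bk s y ybar))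

/-- `V` minimizes the gross error sensitivity among all potentials. -/
def IsOptimalPotential {n : ℕ} (s y : Fin n → ℝ) (Y : Set (Fin n → ℝ)) (V : ℝ → ℝ) : Prop :=
  IsPotential n V ∧
    ∀ W : ℝ → ℝ, IsPotential n W → grossErrorSensitivity V s y Y ≤ grossErrorSensitivity W s y Y

/-- `V` is the negative logarithm on `(0, ∞)`, up to a positive factor (and an additive constant,
which does not change the divergence). -/
def IsNegLog (V : ℝ → ℝ) : Prop :=
  ∃ c d : ℝ, 0 < c ∧ ∀ z : ℝ, 0 < z → V z = c * (-Real.log z) + d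

end QuasiNewton

end

/-! Write ν, β for `nu V`, `beta V`. Since ∇φ(B) = -ν(det B) B⁻¹, stationarity under Bs = y suggests
B = r · `deflation` Bk s + yyᵀ/(sᵀy) with r = ν(det B)/ν(det Bk). Taking determinants turns this
into z/ν(z)^(n-1) = K for z = det B, where K depends only on Bk, s, y. The left side has derivative
(1-(n-1)β)/ν^(n-1) > 0 and takes every positive value, so z is determined (`exists_nuRatio_eq`). The
candidate is the strict minimizer because D_V obeys a Pythagorean identity on the constraint set and
D_V(P,Q) > 0 for P ≠ Q (`divergence_pos`, `trace_inv_mul_eq`, `vBregman_vUpdate_lt`).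

Replacing s by (1+ε)s leaves `deflation` unchanged, so the influence function is `ratioDeriv` ·
`deflation` + `outerDeriv`. The last term involves neither V nor Bk, and `ratioDeriv` is a multiple
of β(z)(sᵀȳ - sᵀy). It vanishes for the logarithm, where β = 0, and whenever sᵀȳ = sᵀy. Otherwise
β(z) ≠ 0 for some z. As n ≥ 3, there are Bk with det Bk = z and sᵀBks = sᵀy, which fixes
`ratioDeriv` ≠ 0, while the deflation is arbitrarily large (`exists_posDef_det_eq_deflation_eq`), so
the sensitivity is infinite. -/

noncomputable section

namespace QuasiNewton

/-! ### Scalar analysis of potentials -/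

section Scalar

variable {n : ℕ} {V : ℝ → ℝ} {z : ℝ}

theorem IsPotential.hasDerivAt (hV : IsPotential n V) (hz : 0 < z) :
    HasDerivAt V (-(nu V z) / z) z := by
  have h1 : DifferentiableAt ℝ V z :=
    (hV.contDiffOn.contDiffAt (Ioi_mem_nhds hz)).differentiableAt (by norm_num)
  convert! h1.hasDerivAt using 1
  unfold nu
  field_simp

theorem IsPotential.contDiffOn_nu (hV : IsPotential n V) : ContDiffOn ℝ 2 (nu V) (Ioi 0) :=
  contDiffOn_id.neg.mul (hV.contDiffOn.deriv_of_isOpen isOpen_Ioi (by norm_num))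

theorem IsPotential.hasDerivAt_nu (hV : IsPotential n V) (hz : 0 < z) :
    HasDerivAt (nu V) (beta V z * nu V z / z) z := by
  have h1 : DifferentiableAt ℝ (nu V) z :=
    (hV.contDiffOn_nu.contDiffAt (Ioi_mem_nhds hz)).differentiableAt (by norm_num)
  convert! h1.hasDerivAt using 1
  have := (hV.nu_pos z hz).ne'
  unfold beta
  field_simp

/-- The function `z / ν_V(z)^k`. -/
def nuRatio (V : ℝ → ℝ) (k : ℕ) (z : ℝ) : ℝ := z / nu V z ^ k

theorem IsPotential.nuRatio_pos (hV : IsPotential n V) (k : ℕ) (hz : 0 < z) :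
    0 < nuRatio V k z :=
  div_pos hz (pow_pos (hV.nu_pos z hz) k)

theorem IsPotential.hasDerivAt_nuRatio (hV : IsPotential n V) (k : ℕ) (hz : 0 < z) :
    HasDerivAt (nuRatio V k) ((1 - k * beta V z) / nu V z ^ k) z := by
  have hp := hV.nu_pos z hz
  have h := (hasDerivAt_id z).div ((hV.hasDerivAt_nu hz).pow k) (pow_pos hp k).ne'
  convert! h using 1
  rcases k with _ | k
  · simp
  · simp only [id, Nat.add_sub_cancel, Pi.pow_apply]
    rw [pow_succ]
    field_simp

theorem IsPotential.natCast_mul_beta_lt_one (hV : IsPotential n V) (hn : 0 < n) {k : ℕ}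
    (hk : k ≤ n) (hz : 0 < z) : k * beta V z < 1 := by
  have h := hV.beta_lt z hz
  have hn' : (0 : ℝ) < n := by exact_mod_cast hn
  have hk' : (k : ℝ) ≤ n := by exact_mod_cast hk
  rw [lt_div_iff₀ hn'] at h
  rcases le_or_gt (beta V z) 0 with hb | hb
  · nlinarith [mul_nonneg (Nat.cast_nonneg (α := ℝ) k) (neg_nonneg.2 hb)]
  · nlinarith

/-- The case k = n-1 makes the determinant equation uniquely solvable; the case k = n gives the
convexity of τ ↦ V(τ^n). -/
theorem IsPotential.strictMonoOn_nuRatio (hV : IsPotential n V) (hn : 0 < n) {k : ℕ}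
    (hk : k ≤ n) : StrictMonoOn (nuRatio V k) (Ioi 0) := by
  refine strictMonoOn_of_deriv_pos (convex_Ioi 0)
    (fun x hx => (hV.hasDerivAt_nuRatio k hx).continuousAt.continuousWithinAt) fun x hx => ?_
  rw [interior_Ioi] at hx
  rw [(hV.hasDerivAt_nuRatio k hx).deriv]
  exact div_pos (by linarith [hV.natCast_mul_beta_lt_one hn hk hx])
    (pow_pos (hV.nu_pos x hx) k)

theorem IsPotential.hasStrictDerivAt_nuRatio (hV : IsPotential n V) (k : ℕ) (hz : 0 < z) :
    HasStrictDerivAt (nuRatio V k) ((1 - k * beta V z) / nu V z ^ k) z := by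
  have h : ContDiffAt ℝ 2 (nuRatio V k) z :=
    contDiffAt_id.div ((hV.contDiffOn_nu.contDiffAt (Ioi_mem_nhds hz)).pow k)
      (pow_pos (hV.nu_pos z hz) k).ne'
  have h2 := h.hasStrictDerivAt (by norm_num)
  rwa [(hV.hasDerivAt_nuRatio k hz).deriv] at h2

/-- A potential has a prescribed limit only at 0. This identity supplies growth at infinity: the
last factor is increasing in z, so the n-th power grows at least linearly. -/
theorem nuRatio_pred_pow (hn : 0 < n) :
    nuRatio V (n - 1) z ^ n = z * nuRatio V n z ^ (n - 1) := by
  obtain ⟨m, rfl⟩ : ∃ m, n = m + 1 := ⟨n - 1, by omega⟩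
  simp only [nuRatio, Nat.add_sub_cancel, div_pow, ← pow_mul, mul_comm m (m + 1)]
  rw [pow_succ']
  ring

theorem IsPotential.exists_nuRatio_eq (hV : IsPotential n V) (hn : 0 < n) {K : ℝ} (hK : 0 < K) :
    ∃ z, 0 < z ∧ nuRatio V (n - 1) z = K := by
  obtain ⟨a, ha0, haK⟩ : ∃ a, 0 < a ∧ nuRatio V (n - 1) a < K := by
    have h := (hV.tendsto_zero.eventually (gt_mem_nhds hK)).and self_mem_nhdsWithin
    obtain ⟨a, h1, h2⟩ := h.exists
    exact ⟨a, h2, h1⟩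
  obtain ⟨b, hb0, hbK⟩ : ∃ b, 0 < b ∧ K < nuRatio V (n - 1) b := by
    set q := nuRatio V n 1 ^ (n - 1)
    have hq : 0 < q := pow_pos (hV.nuRatio_pos n one_pos) _
    have hKq : 0 < K ^ n / q := by positivity
    -- For z ≥ 1 the n-th power is at least z * q; the summand 1 ensures both z ≥ 1 and strictness.
    refine ⟨K ^ n / q + 1, by positivity, ?_⟩
    refine lt_of_pow_lt_pow_left₀ n (hV.nuRatio_pos _ (by positivity)).le ?_
    rw [nuRatio_pred_pow hn]
    have h1 : q ≤ nuRatio V n (K ^ n / q + 1) ^ (n - 1) :=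
      pow_le_pow_left₀ (hV.nuRatio_pos n one_pos).le
        ((hV.strictMonoOn_nuRatio hn le_rfl).monotoneOn (mem_Ioi.2 one_pos)
          (mem_Ioi.2 (by positivity)) (by linarith)) _
    calc K ^ n = K ^ n / q * q := by field_simp
      _ < (K ^ n / q + 1) * q := by nlinarith
      _ ≤ _ := by gcongr
  have hc : ContinuousOn (nuRatio V (n - 1)) (Ioi 0) := fun x hx =>
    (hV.hasDerivAt_nuRatio _ hx).continuousAt.continuousWithinAt
  obtain ⟨c, hc0, hcK⟩ := isPreconnected_Ioi.intermediate_value (mem_Ioi.2 ha0) (mem_Ioi.2 hb0) hc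
    ⟨haK.le, hbK.le⟩
  exact ⟨c, hc0, hcK⟩

open Classical in
/-- The inverse of the function `z / ν_V(z)^(n-1)` on the positive reals. -/
def nuRatioInv (n : ℕ) (V : ℝ → ℝ) (K : ℝ) : ℝ :=
  if h : ∃ z, 0 < z ∧ nuRatio V (n - 1) z = K then h.choose else 0

theorem IsPotential.nuRatioInv_pos (hV : IsPotential n V) (hn : 0 < n) {K : ℝ} (hK : 0 < K) :
    0 < nuRatioInv n V K := by
  have h := hV.exists_nuRatio_eq hn hK
  rw [nuRatioInv, dif_pos h]
  exact h.choose_spec.1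

theorem IsPotential.nuRatio_nuRatioInv (hV : IsPotential n V) (hn : 0 < n) {K : ℝ} (hK : 0 < K) :
    nuRatio V (n - 1) (nuRatioInv n V K) = K := by
  have h := hV.exists_nuRatio_eq hn hK
  rw [nuRatioInv, dif_pos h]
  exact h.choose_spec.2

theorem IsPotential.nuRatioInv_nuRatio (hV : IsPotential n V) (hn : 0 < n) (hz : 0 < z) :
    nuRatioInv n V (nuRatio V (n - 1) z) = z :=
  have hK := hV.nuRatio_pos (n - 1) hz
  (hV.strictMonoOn_nuRatio hn (Nat.sub_le n 1)).injOn (hV.nuRatioInv_pos hn hK) hz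
    (hV.nuRatio_nuRatioInv hn hK)

/-- A local left inverse of a map with nonzero strict derivative is itself differentiable, so
continuity of the inverse needs no separate argument. -/
theorem IsPotential.hasDerivAt_nuRatioInv (hV : IsPotential n V) (hn : 0 < n) {K : ℝ}
    (hK : 0 < K) :
    HasDerivAt (nuRatioInv n V)
      ((1 - (n - 1 : ℕ) * beta V (nuRatioInv n V K)) /
        nu V (nuRatioInv n V K) ^ (n - 1))⁻¹ K := by
  have hz := hV.nuRatioInv_pos hn hK
  have h := (hV.hasStrictDerivAt_nuRatio (n - 1) hz).to_local_left_inverse (g := nuRatioInv n V)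
    (div_pos (by linarith [hV.natCast_mul_beta_lt_one hn (Nat.sub_le n 1) hz])
      (pow_pos (hV.nu_pos _ hz) _)).ne'
    ((lt_mem_nhds hz).mono fun x hx => hV.nuRatioInv_nuRatio hn hx)
  rw [hV.nuRatio_nuRatioInv hn hK] at h
  exact h.hasDerivAt

/-- The function `τ ↦ V(τ^n)` is strictly convex. -/
theorem IsPotential.strictConvexOn_comp_pow (hV : IsPotential n V) (hn : 0 < n) :
    StrictConvexOn ℝ (Ioi 0) fun t : ℝ => V (t ^ n) := by
  have hd : ∀ t : ℝ, 0 < t →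
      HasDerivAt (fun t : ℝ => V (t ^ n)) (-(n * nu V (t ^ n) / t)) t := by
    intro t ht
    convert! (hV.hasDerivAt (pow_pos ht n)).comp t (hasDerivAt_pow n t) using 1
    obtain ⟨m, rfl⟩ : ∃ m, n = m + 1 := ⟨n - 1, by omega⟩
    simp only [Nat.add_sub_cancel]
    field_simp
    ring
  refine StrictMonoOn.strictConvexOn_of_deriv (convex_Ioi 0)
    (fun x hx => (hd x hx).continuousAt.continuousWithinAt) ?_
  rw [interior_Ioi]
  intro a ha b hb hab
  rw [mem_Ioi] at ha hb
  rw [(hd a ha).deriv, (hd b hb).deriv, neg_lt_neg_iff, mul_div_assoc, mul_div_assoc]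
  have hn' : (0 : ℝ) < n := by exact_mod_cast hn
  refine mul_lt_mul_of_pos_left ?_ hn'
  have hA := hV.nu_pos _ (pow_pos ha n)
  have hB := hV.nu_pos _ (pow_pos hb n)
  -- The n-th power of ν(t^n)/t is the reciprocal of `nuRatio V n (t ^ n)`, which increases with t.
  refine lt_of_pow_lt_pow_left₀ n (by positivity) ?_
  have h := hV.strictMonoOn_nuRatio hn le_rfl (mem_Ioi.2 (pow_pos ha n))
    (mem_Ioi.2 (pow_pos hb n)) (pow_lt_pow_left₀ hab ha.le hn.ne')
  unfold nuRatio at h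
  rw [← div_pow, ← div_pow] at h
  have h2 := inv_strictAnti₀ (by positivity) h
  rwa [← inv_pow, ← inv_pow, inv_div, inv_div] at h2

/-- The strict tangent inequality of τ ↦ V(τ^n) at b. It is the divergence of two proportional
matrices whose determinants have n-th roots a and b. -/
theorem IsPotential.tangent_le (hV : IsPotential n V) (hn : 0 < n) {a b : ℝ} (ha : 0 < a)
    (hb : 0 < b) (hab : a ≠ b) :
    0 < V (a ^ n) - V (b ^ n) + n * nu V (b ^ n) * (a / b - 1) := by
  have hc := hV.strictConvexOn_comp_pow hn
  have hd : HasDerivAt (fun t : ℝ => V (t ^ n)) (-(n * nu V (b ^ n) / b)) b := by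
    convert! (hV.hasDerivAt (pow_pos hb n)).comp b (hasDerivAt_pow n b) using 1
    obtain ⟨m, rfl⟩ : ∃ m, n = m + 1 := ⟨n - 1, by omega⟩
    simp only [Nat.add_sub_cancel]
    field_simp
    ring
  have key : n * nu V (b ^ n) * (a / b - 1) = n * nu V (b ^ n) / b * (a - b) := by
    field_simp
  rw [key]
  rcases lt_or_gt_of_ne hab with h | h
  · have := hc.slope_lt_of_hasDerivAt (mem_Ioi.2 ha) (mem_Ioi.2 hb) h hd
    rw [slope_def_field, div_lt_iff₀ (by linarith)] at this
    linarith
  · have := hc.lt_slope_of_hasDerivAt (mem_Ioi.2 hb) (mem_Ioi.2 ha) h hd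
    rw [slope_def_field, lt_div_iff₀ (by linarith)] at this
    linarith

theorem IsNegLog.nu_eq (hV : IsNegLog V) : ∃ c, 0 < c ∧ ∀ z, 0 < z → nu V z = c := by
  obtain ⟨c, d, hc, h⟩ := hV
  refine ⟨c, hc, fun z hz => ?_⟩
  have hd : HasDerivAt (fun z : ℝ => c * (-Real.log z) + d) (c * (-z⁻¹)) z :=
    (((Real.hasDerivAt_log hz.ne').neg).const_mul c).add_const d
  have : V =ᶠ[𝓝 z] fun z : ℝ => c * (-Real.log z) + d :=
    (lt_mem_nhds hz).mono fun x hx => h x hx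
  rw [nu, this.deriv_eq, hd.deriv]
  field_simp

theorem IsNegLog.beta_eq_zero (hV : IsNegLog V) (hz : 0 < z) : beta V z = 0 := by
  obtain ⟨c, -, h⟩ := hV.nu_eq
  have : nu V =ᶠ[𝓝 z] fun _ => c := (lt_mem_nhds hz).mono fun x hx => h x hx
  simp [beta, this.deriv_eq]

theorem IsNegLog.isPotential (hV : IsNegLog V) (hn : 2 ≤ n) : IsPotential n V := by
  obtain ⟨k, hk, hnu⟩ := hV.nu_eq
  have hbeta := fun z (hz : 0 < z) => hV.beta_eq_zero hz
  obtain ⟨c, d, hc, h⟩ := hV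
  refine ⟨?_, ?_, ?_, fun z hz => (hnu z hz).symm ▸ hk, fun z hz => ?_, ?_⟩
  · have hl := strictConcaveOn_log_Ioi.neg
    refine ⟨hl.1, fun x hx y hy hxy a b ha hb hab => ?_⟩
    have h1 := hl.2 hx hy hxy ha hb hab
    have h0 : (0 : ℝ) < a • x + b • y := hl.1 hx hy ha.le hb.le hab
    rw [h _ h0, h _ hx, h _ hy]
    simp only [Pi.neg_apply, smul_eq_mul] at h1 ⊢
    have hd : d = a * d + b * d := by rw [← add_mul, hab, one_mul]
    nlinarith
  · intro x hx y hy hxy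
    rw [h _ hx, h _ hy]
    have := Real.log_le_log hx hxy
    nlinarith
  · refine ContDiffOn.congr (f := fun z : ℝ => c * (-Real.log z) + d) ?_ h
    exact ((contDiffOn_const.mul (Real.contDiffOn_log.mono fun x hx => ne_of_gt hx).neg).add
      contDiffOn_const)
  · rw [hbeta z hz]
    have : (0 : ℝ) < n := by exact_mod_cast (by omega : 0 < n)
    positivity
  · have h1 : Tendsto (fun z : ℝ => z / k ^ (n - 1)) (𝓝[>] 0) (𝓝 0) := by
      have : Tendsto (fun z : ℝ => z / k ^ (n - 1)) (𝓝 0) (𝓝 (0 / k ^ (n - 1))) :=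
        tendsto_id.div_const _
      rw [zero_div] at this
      exact this.mono_left nhdsWithin_le_nhds
    refine h1.congr' ?_
    filter_upwards [self_mem_nhdsWithin] with z hz
    rw [hnu z hz]

/-- If β = 0 then ν is constant, and V' = -ν/z integrates to a logarithm. -/
theorem IsPotential.isNegLog (hV : IsPotential n V) (hb : ∀ z, 0 < z → beta V z = 0) :
    IsNegLog V := by
  have hnu : ∀ z, 0 < z → nu V z = nu V 1 := by
    intro z hz
    refine isOpen_Ioi.is_const_of_deriv_eq_zero isPreconnected_Ioi
      (fun x hx => (hV.hasDerivAt_nu hx).differentiableAt.differentiableWithinAt)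
      (fun x hx => ?_) (mem_Ioi.2 hz) (mem_Ioi.2 one_pos)
    rw [(hV.hasDerivAt_nu hx).deriv, hb x hx]
    simp
  refine ⟨nu V 1, V 1, hV.nu_pos 1 one_pos, fun z hz => ?_⟩
  have hd : ∀ x : ℝ, 0 < x → HasDerivAt (fun x => V x + nu V 1 * Real.log x) 0 x := by
    intro x hx
    have := (hV.hasDerivAt hx).add ((Real.hasDerivAt_log hx.ne').const_mul (nu V 1))
    convert! this using 1
    rw [hnu x hx]
    ring
  have := isOpen_Ioi.is_const_of_deriv_eq_zero isPreconnected_Ioi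
      (fun x hx => (hd x hx).differentiableAt.differentiableWithinAt)
      (fun x hx => (hd x hx).deriv) (mem_Ioi.2 hz) (mem_Ioi.2 one_pos)
  simp only [Real.log_one] at this
  linarith

end Scalar

/-! ### The divergence is positive -/

section Divergence

variable {n : ℕ} {V : ℝ → ℝ}

/-- Strict AM-GM for the eigenvalues, obtained by summing log x ≤ x - 1 over x = eigenvalue / g;
equality would force every eigenvalue to be g. -/
theorem natCast_mul_lt_trace {S : Matrix (Fin n) (Fin n) ℝ} (hS : S.PosDef) {g : ℝ} (hg : 0 < g)
    (hdet : S.det = g ^ n) (hne : S ≠ g • 1) : n * g < S.trace := by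
  set l := hS.1.eigenvalues with hl
  have hpos : ∀ i, 0 < l i := hS.eigenvalues_pos
  have hex : ∃ i, l i ≠ g := by
    by_contra! h
    apply hne
    have hd : (diagonal (RCLike.ofReal ∘ hS.1.eigenvalues) : Matrix (Fin n) (Fin n) ℝ) = g • 1 := by
      rw [smul_one_eq_diagonal]
      congr 1
      funext i
      exact h i
    have := hS.1.spectral_theorem
    rw [hd, map_smul, map_one] at this
    exact this
  obtain ⟨j, hj⟩ := hex
  have hprod : ∏ i, l i = g ^ n := by
    rw [← hdet, hS.1.det_eq_prod_eigenvalues]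
    simp [hl]
  have hlog : ∑ i, Real.log (l i / g) = 0 := by
    rw [← Real.log_prod fun i _ => (div_pos (hpos i) hg).ne', Finset.prod_div_distrib, hprod]
    simp [hg.ne']
  have hlt : ∑ i, Real.log (l i / g) < ∑ i, (l i / g - 1) := by
    refine Finset.sum_lt_sum
      (fun i _ => Real.log_le_sub_one_of_pos (div_pos (hpos i) hg)) ⟨j, Finset.mem_univ j, ?_⟩
    refine Real.log_lt_sub_one_of_pos (div_pos (hpos j) hg) fun h => hj ?_
    rwa [div_eq_one_iff_eq hg.ne'] at h
  have htr : S.trace = ∑ i, l i := by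
    rw [hS.1.trace_eq_sum_eigenvalues]
    simp [hl]
  rw [hlog, Finset.sum_sub_distrib, ← Finset.sum_div, ← htr, sub_pos, lt_div_iff₀ hg] at hlt
  simpa using hlt

theorem exists_eq_mul_self {Q : Matrix (Fin n) (Fin n) ℝ} (hQ : Q.PosDef) :
    ∃ X : Matrix (Fin n) (Fin n) ℝ, Xᴴ = X ∧ Q = X * X := by
  open scoped MatrixOrder in
  obtain ⟨X, hX, -, h⟩ := CFC.exists_sqrt_of_isSelfAdjoint_of_quasispectrumRestricts
    hQ.isHermitian (QuasispectrumRestricts.nnreal_of_nonneg hQ.posSemidef.nonneg)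
  exact ⟨X, hX.star_eq, h.symm⟩

/-- The right side is D_V(P, Q), see `vBregman_eq`. Conjugating P by Q^(-1/2) gives S with det S =
(a/b)^n. If S is scalar, then P ≠ Q forces a ≠ b and the tangent inequality is strict; otherwise
AM-GM is strict and the tangent inequality is needed only in weak form. -/
theorem IsPotential.divergence_pos (hV : IsPotential n V) (hn : 0 < n)
    {P Q : Matrix (Fin n) (Fin n) ℝ} (hP : P.PosDef) (hQ : Q.PosDef) (hPQ : P ≠ Q) :
    0 < V P.det - V Q.det + nu V Q.det * ((Q⁻¹ * P).trace - n) := by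
  obtain ⟨X, hX, rfl⟩ := exists_eq_mul_self hQ
  have hdet : X.det ≠ 0 := fun h => by simpa [h] using hQ.det_pos
  have hu : IsUnit X.det := hdet.isUnit
  have hXi : (X⁻¹)ᴴ = X⁻¹ := by rw [conjTranspose_nonsing_inv, hX]
  have hui : IsUnit X⁻¹ := by
    rw [isUnit_nonsing_inv_iff, isUnit_iff_isUnit_det]
    exact hu
  have hS : (X⁻¹ * P * X⁻¹).PosDef := by
    have := hP.conjTranspose_mul_mul_same (mulVec_injective_of_isUnit hui)
    rwa [hXi] at this
  have htr : ((X * X)⁻¹ * P).trace = (X⁻¹ * P * X⁻¹).trace := by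
    rw [Matrix.mul_inv_rev, Matrix.mul_assoc, trace_mul_comm]
  have hroot : ∀ x : ℝ, 0 < x → 0 < x ^ (n : ℝ)⁻¹ ∧ (x ^ (n : ℝ)⁻¹) ^ n = x := fun x hx =>
    ⟨Real.rpow_pos_of_pos hx _, Real.rpow_inv_natCast_pow hx.le hn.ne'⟩
  obtain ⟨ha, hae⟩ := hroot _ hP.det_pos
  obtain ⟨hb, hbe⟩ := hroot _ hQ.det_pos
  set a := P.det ^ (n : ℝ)⁻¹
  set b := (X * X).det ^ (n : ℝ)⁻¹
  have hg : 0 < a / b := div_pos ha hb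
  have hSdet : (X⁻¹ * P * X⁻¹).det = (a / b) ^ n := by
    rw [div_pow, hae, hbe]
    simp only [det_mul, det_nonsing_inv, Ring.inverse_eq_inv']
    field_simp
  have hnu := hV.nu_pos _ hQ.det_pos
  rw [htr]
  by_cases hne : X⁻¹ * P * X⁻¹ = (a / b) • 1
  · have hPe : P = (a / b) • (X * X) := by
      calc P = X * (X⁻¹ * P * X⁻¹) * X := by
            rw [Matrix.mul_assoc X⁻¹, mul_nonsing_inv_cancel_left _ _ hu,
              nonsing_inv_mul_cancel_right _ _ hu]
        _ = _ := by rw [hne]; simp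
    have hab : a ≠ b := by
      rintro h
      apply hPQ
      rw [hPe, h, div_self hb.ne', one_smul]
    have := hV.tangent_le hn ha hb hab
    rw [hae, hbe] at this
    rw [hne, trace_smul, trace_one, Fintype.card_fin, smul_eq_mul]
    linarith
  · have h1 := natCast_mul_lt_trace hS hg hSdet hne
    have h2 : 0 ≤ V P.det - V (X * X).det + n * nu V (X * X).det * (a / b - 1) := by
      rcases eq_or_ne a b with h | h
      · rw [← hae, ← hbe, h, div_self hb.ne']
        simp
      · have := (hV.tangent_le hn ha hb h).le
        rwa [hae, hbe] at this
    nlinarith [mul_pos hnu (sub_pos.2 h1)]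

theorem det_add_smul_single (Q : Matrix (Fin n) (Fin n) ℝ) (i j : Fin n) (t : ℝ) :
    (Q + t • Matrix.single i j (1 : ℝ)).det = Q.det + t * Q.adjugate j i := by
  have h : Q + t • Matrix.single i j (1 : ℝ) = Q.updateRow i (Q i + t • Pi.single j 1) := by
    ext k l
    rcases eq_or_ne k i with rfl | hk
    · simp [Matrix.single_apply, Pi.single_apply, eq_comm]
    · simp [updateRow_ne hk, hk.symm]
  rw [h, det_updateRow_add, det_updateRow_smul, updateRow_eq_self, adjugate_apply]

theorem IsPotential.grad_comp_det (hV : IsPotential n V) {Q : Matrix (Fin n) (Fin n) ℝ}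
    (hQ : 0 < Q.det) :
    grad (fun M : Matrix (Fin n) (Fin n) ℝ => V M.det) Q = (-nu V Q.det) • (Q⁻¹)ᵀ := by
  ext i j
  simp only [grad, of_apply, det_add_smul_single]
  have h1 : HasDerivAt (fun t : ℝ => Q.det + t * Q.adjugate j i) (Q.adjugate j i) 0 := by
    simpa using ((hasDerivAt_id (0 : ℝ)).mul_const (Q.adjugate j i)).const_add Q.det
  have h2 : HasDerivAt V (-(nu V Q.det) / Q.det) (Q.det + 0 * Q.adjugate j i) := by
    rw [zero_mul, add_zero]
    exact hV.hasDerivAt hQ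
  refine (h2.comp (0 : ℝ) h1).deriv.trans ?_
  rw [Matrix.smul_apply, transpose_apply, inv_def, Matrix.smul_apply,
    Ring.inverse_eq_inv']
  simp only [smul_eq_mul]
  field_simp

theorem IsPotential.vBregman_eq (hV : IsPotential n V) {P Q : Matrix (Fin n) (Fin n) ℝ}
    (hQ : 0 < Q.det) :
    vBregman V P Q = V P.det - V Q.det + nu V Q.det * ((Q⁻¹ * P).trace - n) := by
  have hu : IsUnit Q.det := hQ.ne'.isUnit
  rw [vBregman, bregman, hV.grad_comp_det hQ, frobInner, Matrix.smul_mul, trace_smul,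
    ← transpose_mul, trace_transpose, Matrix.sub_mul, trace_sub, mul_nonsing_inv _ hu, trace_one,
    trace_mul_comm P, Fintype.card_fin, smul_eq_mul]
  ring

end Divergence

/-! ### The update formula -/

section Update

variable {n : ℕ} {V : ℝ → ℝ} {Bk : Matrix (Fin n) (Fin n) ℝ} {s y : Fin n → ℝ}

/-- The degenerate part `Bk - (Bk s sᵀ Bk) / (sᵀ Bk s)` of the BFGS formula. -/
def deflation (Bk : Matrix (Fin n) (Fin n) ℝ) (s : Fin n → ℝ) : Matrix (Fin n) (Fin n) ℝ :=
  Bk - (s ⬝ᵥ Bk *ᵥ s)⁻¹ • (Bk * vecMulVec s s * Bk)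

/-- The BFGS formula with its degenerate part scaled by `r`. -/
def scaledBFGS (r : ℝ) (Bk : Matrix (Fin n) (Fin n) ℝ) (s y : Fin n → ℝ) :
    Matrix (Fin n) (Fin n) ℝ :=
  r • deflation Bk s + (s ⬝ᵥ y)⁻¹ • vecMulVec y y

theorem det_one_add_vecMulVec (u v : Fin n → ℝ) : (1 + vecMulVec u v).det = 1 + v ⬝ᵥ u := by
  rw [← det_one_add_replicateCol_mul_replicateRow (ι := Unit) u v, vecMulVec_eq Unit]

theorem dotProduct_mulVec_pos (hBk : Bk.PosDef) (hs : s ≠ 0) : 0 < s ⬝ᵥ Bk *ᵥ s := by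
  simpa using hBk.dotProduct_mulVec_pos hs

theorem ne_zero_of_dotProduct_pos (hsy : 0 < s ⬝ᵥ y) : s ≠ 0 := by
  rintro rfl
  simp at hsy

theorem transpose_eq (hBk : Bk.PosDef) : Bkᵀ = Bk := by
  simpa [conjTranspose_eq_transpose_of_trivial] using hBk.isHermitian.eq

theorem vecMul_eq_mulVec (hBk : Bk.PosDef) (v : Fin n → ℝ) : v ᵥ* Bk = Bk *ᵥ v := by
  rw [← mulVec_transpose, transpose_eq hBk]

theorem deflation_eq (hBk : Bk.PosDef) (s : Fin n → ℝ) :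
    deflation Bk s = Bk - (s ⬝ᵥ Bk *ᵥ s)⁻¹ • vecMulVec (Bk *ᵥ s) (Bk *ᵥ s) := by
  rw [deflation, mul_vecMulVec, vecMulVec_mul, vecMul_eq_mulVec hBk]

theorem deflation_mulVec (hBk : Bk.PosDef) (hs : s ≠ 0) : deflation Bk s *ᵥ s = 0 := by
  have hσ := (dotProduct_mulVec_pos hBk hs).ne'
  rw [deflation_eq hBk, sub_mulVec, smul_mulVec, vecMulVec_mulVec, dotProduct_comm (Bk *ᵥ s) s]
  ext i
  simp
  field_simp
  simp

theorem deflation_smul {a : ℝ} (ha : a ≠ 0) : deflation Bk (a • s) = deflation Bk s := by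
  simp only [deflation, mulVec_smul, smul_dotProduct, dotProduct_smul, smul_vecMulVec,
    vecMulVec_smul, Matrix.mul_smul, Matrix.smul_mul, smul_smul, smul_eq_mul]
  congr 2
  field_simp

theorem scaledBFGS_mulVec (hBk : Bk.PosDef) (hsy : 0 < s ⬝ᵥ y) (r : ℝ) :
    scaledBFGS r Bk s y *ᵥ s = y := by
  rw [scaledBFGS, add_mulVec, smul_mulVec, deflation_mulVec hBk (ne_zero_of_dotProduct_pos hsy),
    smul_mulVec, vecMulVec_mulVec, dotProduct_comm y s]
  ext i
  simp
  field_simp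

/-- A congruence of Bk by a rank-one perturbation of √r times the identity, from which positivity
and determinant are both read off. The extra factor r avoids the exponent n - 1. -/
theorem exists_scaledBFGS_eq (hBk : Bk.PosDef) (hsy : 0 < s ⬝ᵥ y) {r : ℝ} (hr : 0 < r) :
    ∃ G : Matrix (Fin n) (Fin n) ℝ, scaledBFGS r Bk s y = Gᵀ * Bk * G ∧
      G.det ^ 2 * r = r ^ n * (s ⬝ᵥ y) / (s ⬝ᵥ Bk *ᵥ s) := by
  have hσ := dotProduct_mulVec_pos hBk (ne_zero_of_dotProduct_pos hsy)
  set σ := s ⬝ᵥ Bk *ᵥ s with hσd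
  set ρ := √r with hρd
  have hρ : 0 < ρ := Real.sqrt_pos.2 hr
  have hρ2 : ρ ^ 2 = r := Real.sq_sqrt hr.le
  set α := √(σ * (s ⬝ᵥ y))⁻¹ with hαd
  have hα2 : α ^ 2 = (σ * (s ⬝ᵥ y))⁻¹ := Real.sq_sqrt (by positivity)
  have hbs : (Bk *ᵥ s) ⬝ᵥ s = σ := dotProduct_comm _ _
  -- The term in Bk s makes 1 + s vᵀ the Bk-orthogonal projection along s, which produces the
  -- deflation and kills the cross terms. The term in y contributes α²σ yyᵀ, and α is chosen so that
  -- α²σ = 1/(sᵀy).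
  refine ⟨ρ • (1 + vecMulVec s (-(σ⁻¹ • Bk *ᵥ s) + (α / ρ) • y)), ?_, ?_⟩
  · have h1 : Bk * (ρ • (1 + vecMulVec s (-(σ⁻¹ • Bk *ᵥ s) + (α / ρ) • y))) =
        ρ • (Bk + vecMulVec (Bk *ᵥ s) (-(σ⁻¹ • Bk *ᵥ s) + (α / ρ) • y)) := by
      rw [Matrix.mul_smul, Matrix.mul_add, Matrix.mul_one, mul_vecMulVec]
    rw [Matrix.mul_assoc, h1, transpose_smul, transpose_add, transpose_one, transpose_vecMulVec,
      Matrix.smul_mul, Matrix.mul_smul, smul_smul, Matrix.add_mul, Matrix.one_mul, Matrix.mul_add,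
      vecMulVec_mul, vecMul_eq_mulVec hBk, vecMulVec_mul_vecMulVec, scaledBFGS, deflation_eq hBk]
    rw [← hσd, ← hρ2]
    ext i j
    simp only [Matrix.add_apply, Matrix.smul_apply, Matrix.sub_apply, vecMulVec_apply, Pi.add_apply, Pi.neg_apply,
      Pi.smul_apply, smul_eq_mul]
    have hsy' : (s ⬝ᵥ y)⁻¹ = α ^ 2 * σ := by
      rw [hα2]
      field_simp
    rw [hsy']
    field_simp
    ring
  · rw [det_smul, det_one_add_vecMulVec, add_dotProduct, neg_dotProduct, smul_dotProduct,
      smul_dotProduct, hbs, dotProduct_comm y s, Fintype.card_fin, mul_pow, ← pow_mul,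
      mul_comm n 2, pow_mul, hρ2]
    simp only [smul_eq_mul]
    rw [inv_mul_cancel₀ hσ.ne', add_neg_cancel_left, mul_pow, div_pow, hα2, hρ2]
    field_simp

theorem posDef_scaledBFGS (hBk : Bk.PosDef) (hsy : 0 < s ⬝ᵥ y) {r : ℝ} (hr : 0 < r) :
    (scaledBFGS r Bk s y).PosDef := by
  obtain ⟨G, hG, hdet⟩ := exists_scaledBFGS_eq hBk hsy hr
  have hσ := dotProduct_mulVec_pos hBk (ne_zero_of_dotProduct_pos hsy)
  have h0 : G.det ≠ 0 := by
    intro h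
    have : 0 < r ^ n * (s ⬝ᵥ y) / (s ⬝ᵥ Bk *ᵥ s) := by positivity
    rw [← hdet, h] at this
    simp at this
  rw [hG, ← conjTranspose_eq_transpose_of_trivial]
  exact hBk.conjTranspose_mul_mul_same
    (mulVec_injective_of_isUnit ((isUnit_iff_isUnit_det G).2 h0.isUnit))

theorem det_scaledBFGS (hBk : Bk.PosDef) (hsy : 0 < s ⬝ᵥ y) (hn : 0 < n) {r : ℝ} (hr : 0 < r) :
    (scaledBFGS r Bk s y).det = r ^ (n - 1) * (Bk.det * (s ⬝ᵥ y) / (s ⬝ᵥ Bk *ᵥ s)) := by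
  obtain ⟨G, hG, hdet⟩ := exists_scaledBFGS_eq hBk hsy hr
  obtain ⟨m, rfl⟩ : ∃ m, n = m + 1 := ⟨n - 1, by omega⟩
  have : G.det ^ 2 = r ^ m * (s ⬝ᵥ y) / (s ⬝ᵥ Bk *ᵥ s) := by
    refine mul_right_cancel₀ hr.ne' ?_
    rw [hdet, pow_succ]
    ring
  rw [hG, det_mul, det_mul, det_transpose, Nat.add_sub_cancel]
  calc G.det * Bk.det * G.det = G.det ^ 2 * Bk.det := by ring
    _ = _ := by rw [this]; ring

/-- The first-order optimality condition: on the directions X tangent to the constraint, r B⁻¹ and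
Bk⁻¹ define the same functional. In the expansion of B⁻¹ (B Bk⁻¹) X, every term but the first has
trace zero since Xs = 0 and sᵀX = 0. -/
theorem trace_inv_mul_eq (hBk : Bk.PosDef) (hsy : 0 < s ⬝ᵥ y) {r : ℝ} (hr : 0 < r)
    {X : Matrix (Fin n) (Fin n) ℝ} (hX : Xᵀ = X) (hXs : X *ᵥ s = 0) :
    r * ((scaledBFGS r Bk s y)⁻¹ * X).trace = (Bk⁻¹ * X).trace := by
  set B := scaledBFGS r Bk s y with hB
  have hBp : B.PosDef := posDef_scaledBFGS hBk hsy hr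
  have huB : IsUnit B.det := hBp.det_pos.ne'.isUnit
  have huk : IsUnit Bk.det := hBk.det_pos.ne'.isUnit
  have hsX : s ᵥ* X = 0 := by rw [← mulVec_transpose, hX, hXs]
  have hBiy : B⁻¹ *ᵥ y = s := by
    conv_lhs => rw [← scaledBFGS_mulVec hBk hsy r, ← hB, mulVec_mulVec, nonsing_inv_mul _ huB]
    simp
  have hBks : (Bk *ᵥ s) ᵥ* Bk⁻¹ = s := by
    rw [vecMul_eq_mulVec hBk.inv, mulVec_mulVec, nonsing_inv_mul _ huk, one_mulVec]
  have h1 : B⁻¹ * B * Bk⁻¹ * X = Bk⁻¹ * X := by rw [nonsing_inv_mul _ huB, Matrix.one_mul]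
  have h2 : B⁻¹ * B * Bk⁻¹ * X = r • (B⁻¹ * X) -
      (r * (s ⬝ᵥ Bk *ᵥ s)⁻¹) • vecMulVec (B⁻¹ *ᵥ Bk *ᵥ s) (s ᵥ* X) +
      (s ⬝ᵥ y)⁻¹ • vecMulVec s ((y ᵥ* Bk⁻¹) ᵥ* X) := by
    have : B * Bk⁻¹ = r • 1 - (r * (s ⬝ᵥ Bk *ᵥ s)⁻¹) • vecMulVec (Bk *ᵥ s) s +
        (s ⬝ᵥ y)⁻¹ • vecMulVec y (y ᵥ* Bk⁻¹) := by
      rw [hB, scaledBFGS, deflation_eq hBk, Matrix.add_mul, Matrix.smul_mul, Matrix.sub_mul,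
        mul_nonsing_inv _ huk, Matrix.smul_mul, vecMulVec_mul, hBks, Matrix.smul_mul,
        vecMulVec_mul, smul_sub, smul_smul]
    rw [Matrix.mul_assoc B⁻¹, this]
    simp only [Matrix.mul_add, Matrix.mul_sub, Matrix.mul_smul, Matrix.mul_one, Matrix.add_mul,
      Matrix.sub_mul, Matrix.smul_mul, mul_vecMulVec, vecMulVec_mul, hBiy]
  rw [← h1, h2, hsX]
  simp only [trace_add, trace_sub, trace_smul, trace_vecMulVec, dotProduct_zero, smul_eq_mul]
  rw [dotProduct_comm s (y ᵥ* Bk⁻¹ ᵥ* X), ← dotProduct_mulVec, hXs]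
  simp

/-- The determinant of the solution of the `V`-BFGS problem. -/
def updateDet (V : ℝ → ℝ) (Bk : Matrix (Fin n) (Fin n) ℝ) (s y : Fin n → ℝ) : ℝ :=
  nuRatioInv n V (Bk.det * (s ⬝ᵥ y) / (s ⬝ᵥ Bk *ᵥ s) / nu V Bk.det ^ (n - 1))

/-- The solution of the `V`-BFGS problem. -/
def vUpdate (V : ℝ → ℝ) (Bk : Matrix (Fin n) (Fin n) ℝ) (s y : Fin n → ℝ) :
    Matrix (Fin n) (Fin n) ℝ :=
  scaledBFGS (nu V (updateDet V Bk s y) / nu V Bk.det) Bk s y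

theorem IsPotential.updateDet_arg_pos (hV : IsPotential n V) (hBk : Bk.PosDef)
    (hsy : 0 < s ⬝ᵥ y) :
    0 < Bk.det * (s ⬝ᵥ y) / (s ⬝ᵥ Bk *ᵥ s) / nu V Bk.det ^ (n - 1) := by
  have hσ := dotProduct_mulVec_pos hBk (ne_zero_of_dotProduct_pos hsy)
  have := hV.nu_pos _ hBk.det_pos
  have := hBk.det_pos
  positivity

theorem IsPotential.updateDet_pos (hV : IsPotential n V) (hn : 0 < n) (hBk : Bk.PosDef)
    (hsy : 0 < s ⬝ᵥ y) : 0 < updateDet V Bk s y :=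
  hV.nuRatioInv_pos hn (hV.updateDet_arg_pos hBk hsy)

theorem IsPotential.ratio_pos (hV : IsPotential n V) (hn : 0 < n) (hBk : Bk.PosDef)
    (hsy : 0 < s ⬝ᵥ y) : 0 < nu V (updateDet V Bk s y) / nu V Bk.det :=
  div_pos (hV.nu_pos _ (hV.updateDet_pos hn hBk hsy)) (hV.nu_pos _ hBk.det_pos)

/-- The factor r is built from the root z of the determinant equation; that equation says exactly
that the resulting matrix has determinant z. -/
theorem IsPotential.det_vUpdate (hV : IsPotential n V) (hn : 0 < n) (hBk : Bk.PosDef)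
    (hsy : 0 < s ⬝ᵥ y) : (vUpdate V Bk s y).det = updateDet V Bk s y := by
  have h := hV.nuRatio_nuRatioInv hn (hV.updateDet_arg_pos hBk hsy)
  change nuRatio V (n - 1) (updateDet V Bk s y) = _ at h
  have h1 := (hV.nu_pos _ (hV.updateDet_pos hn hBk hsy)).ne'
  have h2 := (hV.nu_pos _ hBk.det_pos).ne'
  rw [vUpdate, det_scaledBFGS hBk hsy hn (hV.ratio_pos hn hBk hsy), div_pow]
  rw [nuRatio, div_eq_iff (pow_ne_zero _ h1)] at h
  refine Eq.trans ?_ h.symm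
  ring

/-- For feasible B and U the update, D(B, Bk) = D(B, U) + D(U, Bk), because the gradients at U and
Bk agree on B - U. -/
theorem IsPotential.vBregman_vUpdate_lt (hV : IsPotential n V) (hn : 0 < n) (hBk : Bk.PosDef)
    (hsy : 0 < s ⬝ᵥ y) {B : Matrix (Fin n) (Fin n) ℝ} (hB : B.PosDef) (hBs : B *ᵥ s = y)
    (hne : B ≠ vUpdate V Bk s y) :
    vBregman V (vUpdate V Bk s y) Bk < vBregman V B Bk := by
  have hr := hV.ratio_pos hn hBk hsy
  have hU : (vUpdate V Bk s y).PosDef := posDef_scaledBFGS hBk hsy hr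
  have h1 := hV.divergence_pos hn hB hU hne
  have h2 := trace_inv_mul_eq hBk hsy hr (X := B - vUpdate V Bk s y)
    (by rw [transpose_sub, transpose_eq hB, transpose_eq hU])
    (by rw [sub_mulVec, hBs, vUpdate, scaledBFGS_mulVec hBk hsy, sub_self])
  change _ * ((vUpdate V Bk s y)⁻¹ * _).trace = _ at h2
  rw [Matrix.mul_sub, Matrix.mul_sub, trace_sub, trace_sub,
    nonsing_inv_mul _ hU.det_pos.ne'.isUnit, trace_one, Fintype.card_fin,
    div_mul_eq_mul_div, div_eq_iff (hV.nu_pos _ hBk.det_pos).ne', ← hV.det_vUpdate hn hBk hsy] at h2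
  rw [hV.vBregman_eq hBk.det_pos, hV.vBregman_eq hBk.det_pos]
  linarith

theorem IsPotential.isVBFGSUpdate_iff (hV : IsPotential n V) (hn : 0 < n) (hBk : Bk.PosDef)
    (hsy : 0 < s ⬝ᵥ y) {B : Matrix (Fin n) (Fin n) ℝ} :
    IsVBFGSUpdate V Bk s y B ↔ B = vUpdate V Bk s y := by
  have hU : (vUpdate V Bk s y).PosDef := posDef_scaledBFGS hBk hsy (hV.ratio_pos hn hBk hsy)
  have hUs : vUpdate V Bk s y *ᵥ s = y := scaledBFGS_mulVec hBk hsy _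
  constructor
  · rintro ⟨h1, h2, h3⟩
    by_contra hne
    exact absurd (h3 _ hU hUs) (not_le.2 (hV.vBregman_vUpdate_lt hn hBk hsy h1 h2 hne))
  · rintro rfl
    refine ⟨hU, hUs, fun B' h1 h2 => ?_⟩
    rcases eq_or_ne B' (vUpdate V Bk s y) with rfl | hne
    · exact le_rfl
    · exact (hV.vBregman_vUpdate_lt hn hBk hsy h1 h2 hne).le

theorem IsNegLog.vUpdate_eq_bfgs (hV : IsNegLog V) (hn : 2 ≤ n) (hBk : Bk.PosDef)
    (hsy : 0 < s ⬝ᵥ y) : vUpdate V Bk s y = bfgs Bk s y := by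
  obtain ⟨c, hc, h⟩ := hV.nu_eq
  have hP := hV.isPotential hn
  rw [vUpdate, scaledBFGS, h _ (hP.updateDet_pos (by omega) hBk hsy), h _ hBk.det_pos,
    div_self hc.ne', one_smul]
  rfl

end Update

/-! ### The influence function -/

section Influence

variable {n : ℕ} {V : ℝ → ℝ} {Bk : Matrix (Fin n) (Fin n) ℝ} {s y : Fin n → ℝ}

theorem hasDerivAt_matrix {F : ℝ → Matrix (Fin n) (Fin n) ℝ} {F' : Matrix (Fin n) (Fin n) ℝ}
    {x : ℝ} (h : ∀ i j, HasDerivAt (fun t => F t i j) (F' i j) x) : HasDerivAt F F' x :=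
  hasDerivAt_pi.2 fun i => hasDerivAt_pi.2 fun j => h i j

/-- The derivative of the rank-one part of the perturbed update. It depends neither on the
potential nor on the current matrix. -/
def outerDeriv (s y ybar : Fin n → ℝ) : Matrix (Fin n) (Fin n) ℝ :=
  (s ⬝ᵥ y)⁻¹ • (vecMulVec ybar y + vecMulVec y ybar) -
    ((s ⬝ᵥ y + s ⬝ᵥ ybar) / (s ⬝ᵥ y) ^ 2) • vecMulVec y y

/-- The derivative of the factor of the degenerate part of the perturbed update. -/
def ratioDeriv (V : ℝ → ℝ) (Bk : Matrix (Fin n) (Fin n) ℝ) (s y ybar : Fin n → ℝ) : ℝ :=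
  nu V (updateDet V Bk s y) / nu V Bk.det *
    (beta V (updateDet V Bk s y) / (1 - (n - 1 : ℕ) * beta V (updateDet V Bk s y))) *
    ((s ⬝ᵥ ybar - s ⬝ᵥ y) / (s ⬝ᵥ y))

theorem perturbed_dotProduct (s y ybar : Fin n → ℝ) (ε : ℝ) :
    ((1 + ε) • s) ⬝ᵥ (y + ε • ybar) = (1 + ε) * (s ⬝ᵥ y + ε * (s ⬝ᵥ ybar)) := by
  simp only [smul_dotProduct, dotProduct_add, dotProduct_smul, smul_eq_mul]
  ring

theorem hasDerivAt_perturbed_dotProduct (s y ybar : Fin n → ℝ) :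
    HasDerivAt (fun ε : ℝ => ((1 + ε) • s) ⬝ᵥ (y + ε • ybar)) (s ⬝ᵥ y + s ⬝ᵥ ybar) 0 := by
  simp only [perturbed_dotProduct]
  have h1 : HasDerivAt (fun ε : ℝ => 1 + ε) 1 0 := (hasDerivAt_id (0 : ℝ)).const_add 1
  have h2 : HasDerivAt (fun ε : ℝ => s ⬝ᵥ y + ε * (s ⬝ᵥ ybar)) (s ⬝ᵥ ybar) 0 := by
    simpa using ((hasDerivAt_id (0 : ℝ)).mul_const (s ⬝ᵥ ybar)).const_add (s ⬝ᵥ y)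
  simpa using h1.fun_mul h2

theorem hasDerivAt_outer (hsy : 0 < s ⬝ᵥ y) (ybar : Fin n → ℝ) :
    HasDerivAt (fun ε : ℝ => (((1 + ε) • s) ⬝ᵥ (y + ε • ybar))⁻¹ •
      vecMulVec (y + ε • ybar) (y + ε • ybar)) (outerDeriv s y ybar) 0 := by
  refine hasDerivAt_matrix fun i j => ?_
  simp only [Matrix.smul_apply, vecMulVec_apply, Pi.add_apply, Pi.smul_apply, smul_eq_mul]
  have hc : ∀ k, HasDerivAt (fun ε : ℝ => y k + ε * ybar k) (ybar k) 0 := fun k => by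
    simpa using ((hasDerivAt_id (0 : ℝ)).mul_const (ybar k)).const_add (y k)
  have h0 : ((1 + (0 : ℝ)) • s) ⬝ᵥ (y + (0 : ℝ) • ybar) = s ⬝ᵥ y := by simp
  have h := ((hasDerivAt_perturbed_dotProduct s y ybar).fun_inv (h0 ▸ hsy.ne')).fun_mul
    ((hc i).fun_mul (hc j))
  convert! h using 1
  rw [h0]
  simp only [outerDeriv, Matrix.sub_apply, Matrix.smul_apply, Matrix.add_apply, vecMulVec_apply,
    smul_eq_mul]
  ring

/-- Logarithmic derivatives: d log ν / d log z = β and d log K / d log z = 1 - (n-1)β, while d log K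
/ dε = (sᵀȳ - sᵀy)/(sᵀy) at 0, because sᵀBks scales by (1+ε)². -/
theorem IsPotential.hasDerivAt_ratio (hV : IsPotential n V) (hn : 0 < n) (hBk : Bk.PosDef)
    (hsy : 0 < s ⬝ᵥ y) (ybar : Fin n → ℝ) :
    HasDerivAt (fun ε : ℝ => nu V (updateDet V Bk ((1 + ε) • s) (y + ε • ybar)) / nu V Bk.det)
      (ratioDeriv V Bk s y ybar) 0 := by
  have hσ := dotProduct_mulVec_pos hBk (ne_zero_of_dotProduct_pos hsy)
  have hK := hV.updateDet_arg_pos hBk hsy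
  have hz := hV.updateDet_pos hn hBk hsy
  have hKz : updateDet V Bk s y / nu V (updateDet V Bk s y) ^ (n - 1) = _ :=
    hV.nuRatio_nuRatioInv hn hK
  set z := updateDet V Bk s y with hzd
  have hnk := hV.nu_pos _ hBk.det_pos
  have hnz := hV.nu_pos _ hz
  have h0 : ((1 + (0 : ℝ)) • s) ⬝ᵥ (y + (0 : ℝ) • ybar) = s ⬝ᵥ y := by simp
  have hq : HasDerivAt (fun ε : ℝ => ((1 + ε) • s) ⬝ᵥ Bk *ᵥ ((1 + ε) • s))
      (2 * (s ⬝ᵥ Bk *ᵥ s)) 0 := by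
    simp only [mulVec_smul, smul_dotProduct, dotProduct_smul, smul_eq_mul]
    have h1 : HasDerivAt (fun ε : ℝ => 1 + ε) 1 0 := (hasDerivAt_id (0 : ℝ)).const_add 1
    convert! h1.fun_mul (h1.mul_const (s ⬝ᵥ Bk *ᵥ s)) using 1
    ring
  have hq0 : ((1 + (0 : ℝ)) • s) ⬝ᵥ Bk *ᵥ ((1 + (0 : ℝ)) • s) = s ⬝ᵥ Bk *ᵥ s := by simp
  have harg : HasDerivAt (fun ε : ℝ => Bk.det * (((1 + ε) • s) ⬝ᵥ (y + ε • ybar)) /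
      (((1 + ε) • s) ⬝ᵥ Bk *ᵥ ((1 + ε) • s)) / nu V Bk.det ^ (n - 1))
      (z / nu V z ^ (n - 1) * ((s ⬝ᵥ ybar - s ⬝ᵥ y) / (s ⬝ᵥ y))) 0 := by
    convert! (((hasDerivAt_perturbed_dotProduct s y ybar).const_mul Bk.det).fun_div hq
      (hq0 ▸ hσ.ne')).div_const (nu V Bk.det ^ (n - 1)) using 1
    rw [hKz, h0, hq0]
    field_simp
    ring
  have harg0 : Bk.det * (((1 + (0 : ℝ)) • s) ⬝ᵥ (y + (0 : ℝ) • ybar)) /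
      (((1 + (0 : ℝ)) • s) ⬝ᵥ Bk *ᵥ ((1 + (0 : ℝ)) • s)) / nu V Bk.det ^ (n - 1) =
      Bk.det * (s ⬝ᵥ y) / (s ⬝ᵥ Bk *ᵥ s) / nu V Bk.det ^ (n - 1) := by
    rw [h0, hq0]
  have hinv := hV.hasDerivAt_nuRatioInv hn hK
  change HasDerivAt (nuRatioInv n V) ((1 - (n - 1 : ℕ) * beta V z) / nu V z ^ (n - 1))⁻¹ _ at hinv
  have hdet := HasDerivAt.comp (0 : ℝ) (harg0 ▸ hinv) harg
  have hν : HasDerivAt (nu V) (beta V z * nu V z / z)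
      (updateDet V Bk ((1 + (0 : ℝ)) • s) (y + (0 : ℝ) • ybar)) := by
    simpa [← hzd] using hV.hasDerivAt_nu hz
  convert! (HasDerivAt.comp (0 : ℝ) hν hdet).div_const (nu V Bk.det) using 1
  have h1 : 1 - (n - 1 : ℕ) * beta V z ≠ 0 := by
    linarith [hV.natCast_mul_beta_lt_one hn (Nat.sub_le n 1) hz] |> ne_of_gt
  rw [ratioDeriv, ← hzd]
  field_simp

theorem eventually_perturbed_pos (hsy : 0 < s ⬝ᵥ y) (ybar : Fin n → ℝ) :
    ∀ᶠ ε in 𝓝 (0 : ℝ), 0 < 1 + ε ∧ 0 < ((1 + ε) • s) ⬝ᵥ (y + ε • ybar) := by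
  refine Filter.Eventually.and ?_ ?_
  · filter_upwards [lt_mem_nhds (show (-1 : ℝ) < 0 by norm_num)] with ε hε
    linarith
  · refine (hasDerivAt_perturbed_dotProduct s y ybar).continuousAt.eventually
      (lt_mem_nhds (a := 0) ?_)
    simpa using hsy

theorem IsPotential.existsUnique_perturbedUpdate (hV : IsPotential n V) (hn : 0 < n)
    (hBk : Bk.PosDef) (hsy : 0 < s ⬝ᵥ y) (ybar : Fin n → ℝ) :
    ∀ᶠ ε in 𝓝 (0 : ℝ), ∃! B : Matrix (Fin n) (Fin n) ℝ, IsPerturbedUpdate V Bk s y ybar ε B := by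
  filter_upwards [eventually_perturbed_pos hsy ybar] with ε hε
  exact ⟨_, (hV.isVBFGSUpdate_iff hn hBk hε.2).2 rfl,
    fun B hB => (hV.isVBFGSUpdate_iff hn hBk hε.2).1 hB⟩

theorem IsPotential.perturbedUpdate_eventuallyEq (hV : IsPotential n V) (hn : 0 < n)
    (hBk : Bk.PosDef) (hsy : 0 < s ⬝ᵥ y) (ybar : Fin n → ℝ) :
    perturbedUpdate V Bk s y ybar =ᶠ[𝓝 0] fun ε =>
      (nu V (updateDet V Bk ((1 + ε) • s) (y + ε • ybar)) / nu V Bk.det) • deflation Bk s +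
        (((1 + ε) • s) ⬝ᵥ (y + ε • ybar))⁻¹ • vecMulVec (y + ε • ybar) (y + ε • ybar) := by
  filter_upwards [eventually_perturbed_pos hsy ybar] with ε hε
  have h : ∃ B, IsPerturbedUpdate V Bk s y ybar ε B :=
    ⟨_, (hV.isVBFGSUpdate_iff hn hBk hε.2).2 rfl⟩
  rw [perturbedUpdate, dif_pos h, (hV.isVBFGSUpdate_iff hn hBk hε.2).1 h.choose_spec, vUpdate,
    scaledBFGS, deflation_smul hε.1.ne']

theorem IsPotential.hasDerivAt_perturbedUpdate (hV : IsPotential n V) (hn : 0 < n)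
    (hBk : Bk.PosDef) (hsy : 0 < s ⬝ᵥ y) (ybar : Fin n → ℝ) :
    HasDerivAt (perturbedUpdate V Bk s y ybar)
      (ratioDeriv V Bk s y ybar • deflation Bk s + outerDeriv s y ybar) 0 := by
  refine hasDerivAt_matrix fun i j => ?_
  have h1 := hasDerivAt_pi.1 (hasDerivAt_pi.1 (hasDerivAt_outer hsy ybar) i) j
  refine (((hV.hasDerivAt_ratio hn hBk hsy ybar).mul_const (deflation Bk s i j)).fun_add
    h1).congr_of_eventuallyEq ?_
  filter_upwards [hV.perturbedUpdate_eventuallyEq hn hBk hsy ybar] with ε hε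
  rw [hε]
  rfl

theorem IsPotential.influence_eq (hV : IsPotential n V) (hn : 0 < n)
    (hBk : Bk.PosDef) (hsy : 0 < s ⬝ᵥ y) (ybar : Fin n → ℝ) :
    influence V Bk s y ybar = ratioDeriv V Bk s y ybar • deflation Bk s + outerDeriv s y ybar :=
  HasDerivAt.deriv (F := Fin n → Fin n → ℝ) (hV.hasDerivAt_perturbedUpdate hn hBk hsy ybar)

theorem IsPotential.differentiableAt_perturbedUpdate (hV : IsPotential n V) (hn : 0 < n)
    (hBk : Bk.PosDef) (hsy : 0 < s ⬝ᵥ y) (ybar : Fin n → ℝ) :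
    DifferentiableAt ℝ (perturbedUpdate V Bk s y ybar) 0 :=
  HasDerivAt.differentiableAt (F := Fin n → Fin n → ℝ)
    (hV.hasDerivAt_perturbedUpdate hn hBk hsy ybar)

theorem IsNegLog.influence_eq (hV : IsNegLog V) (hn : 2 ≤ n) (hBk : Bk.PosDef)
    (hsy : 0 < s ⬝ᵥ y) (ybar : Fin n → ℝ) : influence V Bk s y ybar = outerDeriv s y ybar := by
  have hP := hV.isPotential hn
  rw [hP.influence_eq (by omega) hBk hsy, ratioDeriv,
    hV.beta_eq_zero (hP.updateDet_pos (by omega) hBk hsy)]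
  simp

theorem IsPotential.influence_eq_of_dotProduct_eq (hV : IsPotential n V) (hn : 0 < n)
    (hBk : Bk.PosDef) (hsy : 0 < s ⬝ᵥ y) {ybar : Fin n → ℝ} (h : s ⬝ᵥ ybar = s ⬝ᵥ y) :
    influence V Bk s y ybar = outerDeriv s y ybar := by
  rw [hV.influence_eq hn hBk hsy, ratioDeriv, h]
  simp

end Influence

/-! ### The gross error sensitivity -/

section Sensitivity

variable {n : ℕ} {V : ℝ → ℝ} {s y : Fin n → ℝ} {Y : Set (Fin n → ℝ)}

theorem frobInner_self (X : Matrix (Fin n) (Fin n) ℝ) : frobInner X X = ∑ i, ∑ j, X i j ^ 2 := by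
  simp only [frobInner, trace, diag_apply, mul_apply, transpose_apply, sq]

/-- Cauchy-Schwarz over index pairs, with weights w i * w j. It lets a single quadratic form bound
the Frobenius norm from below. -/
theorem abs_dotProduct_mulVec_le (X : Matrix (Fin n) (Fin n) ℝ) (w : Fin n → ℝ) :
    |w ⬝ᵥ X *ᵥ w| ≤ frobNorm X * (w ⬝ᵥ w) := by
  have h0 : 0 ≤ w ⬝ᵥ w := Finset.sum_nonneg fun i _ => mul_self_nonneg _
  refine abs_le_of_sq_le_sq ?_ (mul_nonneg (Real.sqrt_nonneg _) h0)
  have hX : 0 ≤ frobInner X X := by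
    rw [frobInner_self]
    positivity
  rw [mul_pow, frobNorm, Real.sq_sqrt hX, frobInner_self, ← Fintype.sum_prod_type']
  have h1 : w ⬝ᵥ X *ᵥ w = ∑ p : Fin n × Fin n, X p.1 p.2 * (w p.1 * w p.2) := by
    rw [Fintype.sum_prod_type]
    simp only [dotProduct, mulVec, Finset.mul_sum]
    exact Finset.sum_congr rfl fun i _ => Finset.sum_congr rfl fun j _ => by ring
  have h2 : (w ⬝ᵥ w) ^ 2 = ∑ p : Fin n × Fin n, (w p.1 * w p.2) ^ 2 := by
    rw [Fintype.sum_prod_type, sq, dotProduct, Finset.sum_mul_sum]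
    exact Finset.sum_congr rfl fun i _ => Finset.sum_congr rfl fun j _ => by ring
  rw [h1, h2]
  exact Finset.sum_mul_sq_le_sq_mul_sq _ _ _

theorem continuous_frobNorm_outerDeriv (s y : Fin n → ℝ) :
    Continuous fun ybar => frobNorm (outerDeriv s y ybar) := by
  simp only [frobNorm, frobInner_self, outerDeriv, Matrix.sub_apply, Matrix.smul_apply,
    Matrix.add_apply, vecMulVec_apply, smul_eq_mul, dotProduct]
  fun_prop

theorem grossErrorSensitivity_congr {W : ℝ → ℝ}
    (h : ∀ Bk : Matrix (Fin n) (Fin n) ℝ, Bk.PosDef → ∀ ybar ∈ Y,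
      influence V Bk s y ybar = influence W Bk s y ybar) :
    grossErrorSensitivity V s y Y = grossErrorSensitivity W s y Y :=
  iSup_congr fun Bk => iSup_congr fun hBk => iSup_congr fun ybar => iSup_congr fun hy => by
    rw [h Bk hBk ybar hy]

/-- The influence reduces to `outerDeriv`, which is free of Bk and continuous in ȳ, hence bounded on
the compact closure of Y. -/
theorem IsNegLog.grossErrorSensitivity_lt_top (hV : IsNegLog V) (hn : 2 ≤ n)
    (hsy : 0 < s ⬝ᵥ y) (hY : Bornology.IsBounded Y) : grossErrorSensitivity V s y Y < ⊤ := by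
  obtain ⟨C, hC⟩ := (hY.isCompact_closure.image (continuous_frobNorm_outerDeriv s y)).bddAbove
  refine lt_of_le_of_lt ?_ (ENNReal.ofReal_lt_top (r := C))
  refine iSup_le fun Bk => iSup_le fun hBk => iSup_le fun ybar => iSup_le fun hy => ?_
  rw [hV.influence_eq hn hBk hsy]
  exact ENNReal.ofReal_le_ofReal (hC ⟨ybar, subset_closure hy, rfl⟩)

/-- In coordinates where s lies on the first axis and w is the second basis vector, Bk is diagonal
with entries 1, t, c/t, 1, …. The third axis compensates the determinant, hence n ≥ 3. The vector w
does not depend on t. -/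
theorem exists_posDef_det_eq_deflation_eq (hn : 3 ≤ n) (hs : s ≠ 0) {σ z : ℝ} (hσ : 0 < σ)
    (hz : 0 < z) : ∃ w : Fin n → ℝ, ∀ t : ℝ, 0 < t → ∃ Bk : Matrix (Fin n) (Fin n) ℝ,
      Bk.PosDef ∧ Bk.det = z ∧ s ⬝ᵥ Bk *ᵥ s = σ ∧ w ⬝ᵥ deflation Bk s *ᵥ w = t := by
  obtain ⟨m, rfl⟩ : ∃ m, n = m + 3 := ⟨n - 3, by omega⟩
  have hσ' : √σ ≠ 0 := (Real.sqrt_pos.2 hσ).ne'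
  have he0 : √σ • (Pi.single 0 1 : Fin (m + 3) → ℝ) ≠ 0 := by
    intro h
    have := congrFun h 0
    simp [hσ'] at this
  obtain ⟨e, he⟩ := SeparatingDual.exists_continuousLinearEquiv_apply_eq (R := ℝ) hs he0
  set M : Matrix (Fin (m + 3)) (Fin (m + 3)) ℝ := LinearMap.toMatrix' (e : _ →ₗ[ℝ] _) with hM
  have hMv : ∀ v, M *ᵥ v = e v := fun v => by
    rw [hM, LinearMap.toMatrix'_mulVec]
    rfl
  have hinj : Function.Injective M.mulVec := fun a b hab => e.injective (by
    rw [← hMv, ← hMv]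
    exact hab)
  have hdet : M.det ≠ 0 :=
    ((isUnit_iff_isUnit_det M).1 (mulVec_injective_iff_isUnit.1 hinj)).ne_zero
  refine ⟨e.symm (Pi.single 1 1), fun t ht => ?_⟩
  -- Cancels the factor (det M)² that the change of coordinates introduces.
  set c := z / M.det ^ 2 with hc
  have hc0 : 0 < c := by positivity
  set d : Fin (m + 3) → ℝ := vecCons 1 (vecCons t (vecCons (c / t) fun _ => 1)) with hd
  have hform : ∀ u v, u ⬝ᵥ (Mᵀ * diagonal d * M) *ᵥ v = (M *ᵥ u) ⬝ᵥ diagonal d *ᵥ (M *ᵥ v) := by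
    intro u v
    rw [← mulVec_mulVec, ← mulVec_mulVec, dotProduct_mulVec, vecMul_transpose]
  have hw : M *ᵥ e.symm (Pi.single 1 1) = Pi.single 1 1 := by rw [hMv, e.apply_symm_apply]
  have hMs : M *ᵥ s = √σ • Pi.single 0 1 := by rw [hMv, he]
  have hpd : (Mᵀ * diagonal d * M).PosDef := by
    rw [← conjTranspose_eq_transpose_of_trivial]
    refine PosDef.conjTranspose_mul_mul_same (PosDef.diagonal fun i => ?_) hinj
    refine Fin.cases ?_ (fun i => Fin.cases ?_ (fun i => Fin.cases ?_ (fun i => ?_) i) i) i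
    · simp [hd]
    · simpa [hd] using ht
    · have : 0 < c / t := by positivity
      simpa [hd] using this
    · simp [hd]
  refine ⟨Mᵀ * diagonal d * M, hpd, ?_, ?_, ?_⟩
  · have hprod : ∏ i, d i = c := by
      simp only [hd, Fin.prod_univ_succ, cons_val_zero, cons_val_succ, Finset.prod_const_one]
      field_simp
    rw [det_mul, det_mul, det_transpose, det_diagonal, hprod, hc]
    field_simp
  · rw [hform, hMs, mulVec_smul, smul_dotProduct, dotProduct_smul, smul_smul,
      Real.mul_self_sqrt hσ.le]
    simp [hd]
  · have h1 : e.symm (Pi.single 1 1) ⬝ᵥ (Mᵀ * diagonal d * M) *ᵥ e.symm (Pi.single 1 1) = t := by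
      rw [hform, hw]
      simp [hd]
    -- As w is Bk-orthogonal to s, the deflation has the same value as Bk on w.
    have h2 : e.symm (Pi.single 1 1) ⬝ᵥ (Mᵀ * diagonal d * M) *ᵥ s = 0 := by
      rw [hform, hw, hMs]
      simp [mulVec_smul]
    rw [deflation_eq hpd, sub_mulVec, smul_mulVec, vecMulVec_mulVec, dotProduct_sub, h1]
    simp [h2]

theorem IsPotential.grossErrorSensitivity_eq_top (hV : IsPotential n V) (hn : 3 ≤ n)
    (hsy : 0 < s ⬝ᵥ y) (hlog : ¬ IsNegLog V) (hY : ∃ ybar ∈ Y, s ⬝ᵥ ybar ≠ s ⬝ᵥ y) :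
    grossErrorSensitivity V s y Y = ⊤ := by
  have hn0 : 0 < n := by omega
  obtain ⟨ybar, hmem, hne⟩ := hY
  obtain ⟨z, hz, hβ⟩ : ∃ z, 0 < z ∧ beta V z ≠ 0 := by
    by_contra! h
    exact hlog (hV.isNegLog h)
  obtain ⟨w, hw⟩ := exists_posDef_det_eq_deflation_eq hn (ne_zero_of_dotProduct_pos hsy) hsy hz
  set κ := beta V z / (1 - (n - 1 : ℕ) * beta V z) * ((s ⬝ᵥ ybar - s ⬝ᵥ y) / (s ⬝ᵥ y)) with hκd
  have hκ : κ ≠ 0 :=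
    mul_ne_zero (div_ne_zero hβ
      (by linarith [hV.natCast_mul_beta_lt_one hn0 (Nat.sub_le n 1) hz] |> ne_of_gt))
      (div_ne_zero (sub_ne_zero.2 hne) hsy.ne')
  set c := w ⬝ᵥ outerDeriv s y ybar *ᵥ w
  have key : ∀ t : ℝ, 0 < t → ∃ Bk : Matrix (Fin n) (Fin n) ℝ, Bk.PosDef ∧
      |κ * t + c| ≤ frobNorm (influence V Bk s y ybar) * (w ⬝ᵥ w) := by
    intro t ht
    obtain ⟨Bk, hBk, hdet, hσ, hdef⟩ := hw t ht
    refine ⟨Bk, hBk, ?_⟩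
    -- With det Bk = z and sᵀBks = sᵀy, the determinant equation is solved by z itself; hence r = 1
    -- and `ratioDeriv` is the constant κ, whatever t.
    have hu : updateDet V Bk s y = z := by
      rw [updateDet, hdet, hσ, mul_div_cancel_right₀ _ hsy.ne']
      exact hV.nuRatioInv_nuRatio hn0 hz
    have hr : ratioDeriv V Bk s y ybar = κ := by
      rw [ratioDeriv, hu, hdet, div_self (hV.nu_pos z hz).ne', one_mul]
    have h := abs_dotProduct_mulVec_le (influence V Bk s y ybar) w
    rw [hV.influence_eq hn0 hBk hsy, hr, add_mulVec, smul_mulVec, dotProduct_add,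
      dotProduct_smul, hdef, smul_eq_mul] at h
    rwa [hV.influence_eq hn0 hBk hsy, hr]
  by_contra htop
  set N := (grossErrorSensitivity V s y Y).toReal
  have hN : ∀ Bk : Matrix (Fin n) (Fin n) ℝ, Bk.PosDef →
      frobNorm (influence V Bk s y ybar) ≤ N := by
    intro Bk hBk
    refine (ENNReal.ofReal_le_iff_le_toReal htop).1 ?_
    exact le_iSup₂_of_le Bk hBk (le_iSup₂_of_le ybar hmem le_rfl)
  have hw0 : 0 ≤ w ⬝ᵥ w := Finset.sum_nonneg fun i _ => mul_self_nonneg _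
  have hN0 : 0 ≤ N := ENNReal.toReal_nonneg
  have hκ' : 0 < |κ| := abs_pos.2 hκ
  -- At t = T/|κ| the quadratic form of the influence has modulus at least T - |c|, beyond the bound
  -- N (wᵀw).
  set T := N * (w ⬝ᵥ w) + |c| + 1 with hT
  have hT0 : 0 < T := by positivity
  obtain ⟨Bk, hBk, h⟩ := key (T / |κ|) (by positivity)
  have h1 : |κ * (T / |κ|)| = T := by
    rw [abs_mul, abs_div, abs_abs, abs_of_pos hT0]
    field_simp
  have h2 : |κ * (T / |κ|)| ≤ |κ * (T / |κ|) + c| + |c| := by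
    simpa using abs_sub (κ * (T / |κ|) + c) c
  have h3 := mul_le_mul_of_nonneg_right (hN Bk hBk) hw0
  linarith

/-- A competitor either has the same influence function on Y, being logarithmic or because sᵀȳ = sᵀy
throughout, or has infinite sensitivity. -/
theorem IsNegLog.isOptimalPotential (hV : IsNegLog V) (hn : 3 ≤ n) (hsy : 0 < s ⬝ᵥ y) :
    IsOptimalPotential s y Y V := by
  have hn2 : 2 ≤ n := by omega
  refine ⟨hV.isPotential hn2, fun W hW => ?_⟩
  by_cases hY : ∃ ybar ∈ Y, s ⬝ᵥ ybar ≠ s ⬝ᵥ y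
  · by_cases hlog : IsNegLog W
    · refine (grossErrorSensitivity_congr fun Bk hBk ybar _ => ?_).le
      rw [hV.influence_eq hn2 hBk hsy, hlog.influence_eq hn2 hBk hsy]
    · rw [hW.grossErrorSensitivity_eq_top hn hsy hlog hY]
      exact le_top
  · push Not at hY
    refine (grossErrorSensitivity_congr fun Bk hBk ybar hy => ?_).le
    rw [hV.influence_eq hn2 hBk hsy,
      hW.influence_eq_of_dotProduct_eq (by omega) hBk hsy (hY ybar hy)]

theorem isNegLog_neg_log : IsNegLog fun z => -Real.log z :=
  ⟨1, 0, one_pos, fun z _ => by simp⟩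

end Sensitivity

end QuasiNewton

end

theorem mainTheorem5 (n : ℕ) (hn : 3 ≤ n) (s y : Fin n → ℝ) (hsy : 0 < s ⬝ᵥ y)
    (Y : Set (Fin n → ℝ)) (hY : Bornology.IsBounded Y) :
    -- the influence function is well defined
    (∀ V : ℝ → ℝ, QuasiNewton.IsPotential n V →
      ∀ Bk : Matrix (Fin n) (Fin n) ℝ, Bk.PosDef → ∀ ybar : Fin n → ℝ,
        (∀ᶠ ε in 𝓝 (0 : ℝ), ∃! B : Matrix (Fin n) (Fin n) ℝ,
          QuasiNewton.IsPerturbedUpdate V Bk s y ybar ε B) ∧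
        DifferentiableAt ℝ (QuasiNewton.perturbedUpdate V Bk s y ybar) 0) ∧
    -- the negative logarithm is optimal, with a finite value, and gives the standard BFGS update
    (∀ V : ℝ → ℝ, QuasiNewton.IsNegLog V →
      QuasiNewton.IsOptimalPotential s y Y V ∧
      QuasiNewton.grossErrorSensitivity V s y Y < ⊤ ∧
      ∀ Bk : Matrix (Fin n) (Fin n) ℝ, Bk.PosDef → ∀ B : Matrix (Fin n) (Fin n) ℝ,
        QuasiNewton.IsVBFGSUpdate V Bk s y B ↔ B = QuasiNewton.bfgs Bk s y) ∧
    -- it is the only optimal potential, and the only one with a finite value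
    ((∃ ybar ∈ Y, s ⬝ᵥ ybar ≠ s ⬝ᵥ y) →
      ∀ V : ℝ → ℝ, QuasiNewton.IsPotential n V →
        (QuasiNewton.IsOptimalPotential s y Y V ↔ QuasiNewton.IsNegLog V) ∧
        (QuasiNewton.grossErrorSensitivity V s y Y < ⊤ ↔ QuasiNewton.IsNegLog V)) ∧
    -- in the remaining case the sensitivity does not depend on the potential
    ((∀ ybar ∈ Y, s ⬝ᵥ ybar = s ⬝ᵥ y) →
      ∀ V W : ℝ → ℝ, QuasiNewton.IsPotential n V → QuasiNewton.IsPotential n W →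
        QuasiNewton.grossErrorSensitivity V s y Y = QuasiNewton.grossErrorSensitivity W s y Y) := by
  have hn0 : 0 < n := by omega
  have hn2 : 2 ≤ n := by omega
  refine ⟨fun V hV Bk hBk ybar => ⟨hV.existsUnique_perturbedUpdate hn0 hBk hsy ybar,
    hV.differentiableAt_perturbedUpdate hn0 hBk hsy ybar⟩, fun V hV => ⟨?_, ?_, ?_⟩, ?_, ?_⟩
  · exact hV.isOptimalPotential hn hsy
  · exact hV.grossErrorSensitivity_lt_top hn2 hsy hY
  · intro Bk hBk B
    rw [(hV.isPotential hn2).isVBFGSUpdate_iff hn0 hBk hsy, hV.vUpdate_eq_bfgs hn2 hBk hsy]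
  · intro hex V hV
    have hfin : QuasiNewton.grossErrorSensitivity V s y Y < ⊤ ↔ QuasiNewton.IsNegLog V := by
      refine ⟨fun h => ?_, fun h => h.grossErrorSensitivity_lt_top hn2 hsy hY⟩
      by_contra hlog
      exact h.ne (hV.grossErrorSensitivity_eq_top hn hsy hlog hex)
    refine ⟨⟨fun h => hfin.1 ?_, fun h => h.isOptimalPotential hn hsy⟩, hfin⟩
    -- An optimal potential does at least as well as -log, so its sensitivity is finite.
    have hlog := QuasiNewton.isNegLog_neg_log
    exact (h.2 _ (hlog.isPotential hn2)).trans_lt (hlog.grossErrorSensitivity_lt_top hn2 hsy hY)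
  · intro hall V W hV hW
    refine QuasiNewton.grossErrorSensitivity_congr fun Bk hBk ybar hy => ?_
    rw [hV.influence_eq_of_dotProduct_eq hn0 hBk hsy (hall ybar hy),
      hW.influence_eq_of_dotProduct_eq hn0 hBk hsy (hall ybar hy)]
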